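/- **Setting.** There are finite sets of students $\mathcal S$, districts $\mathcal D$, schools $\mathcal C$ and types $\mathcal T$. Each student $s$ has a home district $d(s)$, a type $\tau(s)$, an initial school $c_0(s)$ and a strict preference order $P_s$ over schools and being unmatched, the latter being the worst outcome. Each school $c$ belongs to a district $d(c)$ and has a capacity $q_c$. The initial matching $s\mapsto c_0(s)$ respects the capacities. Let $k_d$ be the number of students with home district $d$. A matching assigns at most one school to each student; it is feasible if no school has more students than its capacity. A distribution is a vector $\xi=(\xi_c^t)\in\mathbb Z_+^{|\mathcal C|\times|\mathcal T|}$; $\xi(X)$ is the distribution whose $(c,t)$ entry is the number of type-$t$ students assigned to $c$ at $X$, and $\chi_{c,t}$ is the unit vector at $(c,t)$. Let $$\Xi=\Big\{\xi:\ \sum_{t}\sum_{c:d(c)=d}\xi_c^t=k_d\ \text{ for all } d\Big\},\qquad \Xi^0=\Big\{\xi:\ \sum_{c,t}\xi_c^t=\sum_d k_d,\ \ \sum_t\xi_c^t\le q_c\ \text{ for all } c\Big\}.$$ $\Xi$ is the balanced-exchange policy. A set $A$ of distributions is M-convex if whenever $\xi,\tilde\xi\in A$ and $\xi_c^t>\tilde\xi_c^t$,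 there are $c',t'$ with $\xi_{c'}^{t'}<\tilde\xi_{c'}^{t'}$ such that $\xi-\chi_{c,t}+\chi_{c',t'}\in A$ and $\tilde\xi+\chi_{c,t}-\chi_{c',t'}\in A$. **TTC.** Fix a strict master priority list of the students. For each student $s$ and each $P_s$ fix a strict order $\tilde P_s$ over school-type pairs that ranks the pairs $(c,\tau(s))$ as $P_s$ ranks the schools $c$, and ranks every pair with another type below her initial pair $(c_0(s),\tau(s))$. A pair gives the highest priority to the students whose initial pair it is; ties are broken by the master list. At each step, let $\xi$ be the distribution given by the assignments made so far and the initial pairs of the unassigned students. An unassigned student $s$ is permissible to a pair $(c,t)$ if $\xi+\chi_{c,t}-\chi_{c_0(s),\tau(s)}\in\Xi\cap\Xi^0$. Pairs without an unassigned permissible student are removed from the market; each remaining pair points to its unassigned permissible student with the highest priority; each unassigned student points to the best remaining pair according to $\tilde P_s$; all cycles are executed, that is, each student on a cycle is assigned the pair she points to and leaves. The algorithm stops when every student is assigned, and each student receives the school of her pair. **Corollary 4.** The set $\Xi\cap\Xi^0$ is M-convex. Moreover, if the initial matching satisfies the balanced-exchange policy $\Xi$, then for every master priority list and every choice of the orders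 $\tilde P_s$ as above, the algorithm terminates for every preference profile, and TTC satisfies: 1. feasibility and balanced exchange: the outcome $X$ is feasible, $\xi(X)\in\Xi$, and every district receives as many students from the other districts as it sends to them; 2. constrained efficiency: no feasible matching $Y$ with $\xi(Y)\in\Xi$ Pareto dominates the outcome; 3. individual rationality: every student weakly prefers her outcome to her initial school; 4. strategy-proofness: no student can obtain a strictly preferred outcome by misreporting her preferences. -/

import Mathlib

namespace SchoolChoice

/-- A strict preference (or priority) order on `A`: `P.pref a b` means that `a` is ranked
strictly above `b`. -/
structure StrictPref (A : Type*) where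
  pref : A → A → Prop
  irrefl : ∀ a, ¬ pref a a
  trans : ∀ a b c, pref a b → pref b c → pref a c
  total : ∀ a b, a ≠ b → pref a b ∨ pref b a

/-- The strict preference over schools and the outside option `none`, which is the least
preferred outcome. -/
def StrictPref.over {C : Type*} (P : StrictPref C) : Option C → Option C → Prop
  | some a, some b => P.pref a b
  | some _, none => True
  | none, _ => False

/-- The weak order associated with `StrictPref.over`. -/
def StrictPref.weak {C : Type*} (P : StrictPref C) (x y : Option C) : Prop :=
  P.over x y ∨ x = y

/-- The publicly known components of an interdistrict school choice problem: students `S`,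
districts `D`, schools `C` and student types `T`.  The initial matching gives every student
exactly one school and respects the capacities. -/
structure Problem (S D C T : Type*) [Fintype S] where
  /-- home district of a student -/
  home : S → D
  /-- district of a school -/
  district : C → D
  /-- type of a student -/
  type : S → T
  /-- capacity of a school -/
  cap : C → ℕ
  /-- initial school of a student -/
  init : S → C
  init_feasible : ∀ c, Nat.card {s : S // init s = c} ≤ cap c

/-- A matching that is feasible for students: every student has at most one contract, a
contract of `s` being determined by a school; `none` means that the student is unmatched. -/
abbrev Matching (S C : Type*) := S → Option C

/-- A distribution: `ξ (c, t)` is the number of type-`t` students in school `c`. -/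
abbrev Distribution (C T : Type*) := C × T → ℕ

open Classical in
/-- The distribution with exactly one type-`t` student at school `c`, where `p = (c, t)`. -/
noncomputable def chi {C T : Type*} (p : C × T) : Distribution C T :=
  fun p' => if p' = p then 1 else 0

/-- M-convexity of a set of distributions. The subtractions never truncate, because
`ξ p > ξ' p` and `ξ' p' > ξ p'`. -/
def MConvex {C T : Type*} (Ξ : Set (Distribution C T)) : Prop :=
  ∀ ξ ∈ Ξ, ∀ ξ' ∈ Ξ, ∀ p : C × T, ξ' p < ξ p →
    ∃ p' : C × T, ξ p' < ξ' p' ∧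
      (ξ - chi p) + chi p' ∈ Ξ ∧ (ξ' + chi p) - chi p' ∈ Ξ

/-- A mechanism maps profiles of student preferences to matchings. -/
abbrev Mechanism (S C : Type*) := (S → StrictPref C) → Matching S C

open Classical in
/-- No student ever gets a strictly better outcome by misreporting her preferences. -/
def StrategyProof {S C : Type*} (φ : Mechanism S C) : Prop :=
  ∀ (P : S → StrictPref C) (s : S) (P' : StrictPref C),
    ¬ (P s).over (φ (Function.update P s P') s) (φ P s)

/-- `X` Pareto dominates `Y`. -/
def ParetoDominates {S C : Type*} (P : S → StrictPref C) (X Y : Matching S C) : Prop :=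
  (∀ s, (P s).weak (X s) (Y s)) ∧ ∃ s, (P s).over (X s) (Y s)

namespace Problem

variable {S D C T : Type*} [Fintype S] [Fintype D] [Fintype C] [Fintype T]

/-- The number `k_d` of students whose home district is `d`. -/
noncomputable def numHome (pb : Problem S D C T) (d : D) : ℕ :=
  Nat.card {s : S // pb.home s = d}

/-- Every school has at most as many students as its capacity. -/
def Feasible (pb : Problem S D C T) (X : Matching S C) : Prop :=
  ∀ c, Nat.card {s : S // X s = some c} ≤ pb.cap c

/-- The initial matching. -/
def initMatching (pb : Problem S D C T) : Matching S C := fun s => some (pb.init s)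

/-- The distribution associated with a matching. -/
noncomputable def dist (pb : Problem S D C T) (X : Matching S C) : Distribution C T :=
  fun p => Nat.card {s : S // X s = some p.1 ∧ pb.type s = p.2}

/-- A matching satisfies the policy goal `Ξ` if its distribution is in `Ξ`. -/
def Satisfies (pb : Problem S D C T) (Ξ : Set (Distribution C T)) (X : Matching S C) : Prop :=
  pb.dist X ∈ Ξ

/-- The policy `Ξ⁰`: every student is matched and no school exceeds its capacity. -/
def policyZero (pb : Problem S D C T) : Set (Distribution C T) :=
  {ξ | ∑ c, ∑ t, ξ (c, t) = ∑ d, pb.numHome d ∧ ∀ c, ∑ t, ξ (c, t) ≤ pb.cap c}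

open Classical in
/-- The balanced-exchange policy: the number of students assigned to each district is the
number of students from that district. -/
def balancedPolicy (pb : Problem S D C T) : Set (Distribution C T) :=
  {ξ | ∀ d, ∑ t, ∑ c with pb.district c = d, ξ (c, t) = pb.numHome d}

/-- Every district receives as many students from the other districts as it sends to them. -/
def BalancedExchange (pb : Problem S D C T) (X : Matching S C) : Prop :=
  ∀ d, Nat.card {s : S // pb.home s ≠ d ∧ ∃ c, X s = some c ∧ pb.district c = d} =
    Nat.card {s : S // pb.home s = d ∧ ∃ c, X s = some c ∧ pb.district c ≠ d}

/-- Every student weakly prefers her outcome to her initial school. -/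
def IndividuallyRational (pb : Problem S D C T) (P : S → StrictPref C)
    (X : Matching S C) : Prop :=
  ∀ s, (P s).weak (X s) (pb.initMatching s)

/-- `X` is feasible, satisfies `Ξ`, and is not Pareto dominated by a feasible matching that
satisfies `Ξ`. -/
def ConstrainedEfficient (pb : Problem S D C T) (Ξ : Set (Distribution C T))
    (P : S → StrictPref C) (X : Matching S C) : Prop :=
  pb.Feasible X ∧ pb.Satisfies Ξ X ∧
    ¬ ∃ Y : Matching S C, pb.Feasible Y ∧ pb.Satisfies Ξ Y ∧ ParetoDominates P Y X

/-! ### Top trading cycles -/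

/-- The initial school-type pair of a student in the hypothetical problem. -/
def initPair (pb : Problem S D C T) (s : S) : C × T := (pb.init s, pb.type s)

/-- `Q` is an order over school-type pairs that `s` may have in the hypothetical problem when
her preference is `P`: pairs with her own type are ranked as in `P`, and all pairs with another
type are below her initial pair. -/
def IsPairPref (pb : Problem S D C T) (s : S) (P : StrictPref C)
    (Q : StrictPref (C × T)) : Prop :=
  (∀ c c', P.pref c c' ↔ Q.pref (c, pb.type s) (c', pb.type s)) ∧
  ∀ c t, t ≠ pb.type s → Q.pref (pb.initPair s) (c, t)

/-- Priority of a school-type pair `p`: students initially matched with `p` come first; ties are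
broken by the master priority list. `pb.HigherPriority master p s s'` means that `s` is strictly
above `s'`. -/
def HigherPriority (pb : Problem S D C T) (master : StrictPref S) (p : C × T)
    (s s' : S) : Prop :=
  (pb.initPair s = p ∧ pb.initPair s' ≠ p) ∨
  ((pb.initPair s = p ↔ pb.initPair s' = p) ∧ master.pref s s')

/-- The state of the algorithm at the start of a step: the final assignments made so far
(`none` for the students that have not been processed) and the pairs still in the market. -/
structure TTCState (S C T : Type*) where
  assigned : S → Option (C × T)
  market : Set (C × T)

/-- At the start nobody has been processed and all pairs are in the market. -/
def ttcStart : TTCState S C T := ⟨fun _ => none, Set.univ⟩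

/-- The matching `Xⁿ` (of students to pairs): the assignments made so far, and the initial pairs
of the unprocessed students. -/
def currentPair (pb : Problem S D C T) (σ : TTCState S C T) (s : S) : C × T :=
  (σ.assigned s).getD (pb.initPair s)

/-- The distribution of `Xⁿ`. -/
noncomputable def currentDist (pb : Problem S D C T) (σ : TTCState S C T) : Distribution C T :=
  fun p => Nat.card {s : S // pb.currentPair σ s = p}

/-- `s` is unprocessed and permissible to the pair `p`. The subtraction does not truncate, since
an unprocessed student occupies her initial pair. -/
def Permissible (pb : Problem S D C T) (Ξ : Set (Distribution C T)) (σ : TTCState S C T)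
    (s : S) (p : C × T) : Prop :=
  σ.assigned s = none ∧ (pb.currentDist σ + chi p) - chi (pb.initPair s) ∈ Ξ

/-- The pairs left in the market in the current step: a pair without an unprocessed permissible
student is removed. -/
def remaining (pb : Problem S D C T) (Ξ : Set (Distribution C T)) (σ : TTCState S C T) :
    Set (C × T) :=
  {p | p ∈ σ.market ∧ ∃ s, pb.Permissible Ξ σ s p}

/-- The remaining pair `p` points to `s`, its unprocessed permissible student with the highest
priority. -/
def PairPoints (pb : Problem S D C T) (Ξ : Set (Distribution C T)) (master : StrictPref S)
    (σ : TTCState S C T) (p : C × T) (s : S) : Prop :=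
  p ∈ pb.remaining Ξ σ ∧ pb.Permissible Ξ σ s p ∧
    ∀ s', pb.Permissible Ξ σ s' p → s' ≠ s → pb.HigherPriority master p s s'

/-- The unprocessed student `s` points to `p`, the best remaining pair according to her order
`Q s`. -/
def StudentPoints (pb : Problem S D C T) (Ξ : Set (Distribution C T))
    (Q : S → StrictPref (C × T)) (σ : TTCState S C T) (s : S) (p : C × T) : Prop :=
  σ.assigned s = none ∧ p ∈ pb.remaining Ξ σ ∧
    ∀ p' ∈ pb.remaining Ξ σ, p' ≠ p → (Q s).pref p p'

/-- `s` lies on a directed cycle of alternating students and pairs. -/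
def OnCycle (pb : Problem S D C T) (Ξ : Set (Distribution C T)) (master : StrictPref S)
    (Q : S → StrictPref (C × T)) (σ : TTCState S C T) (s : S) : Prop :=
  Relation.TransGen
    (fun a b => ∃ p, pb.StudentPoints Ξ Q σ a p ∧ pb.PairPoints Ξ master σ p b) s s

open Classical in
/-- One step of the algorithm: pairs without a permissible student leave the market, all cycles
are executed, and every student on a cycle gets the pair that she points to. -/
noncomputable def ttcStep (pb : Problem S D C T) (Ξ : Set (Distribution C T))
    (master : StrictPref S) (Q : S → StrictPref (C × T)) (σ : TTCState S C T) :
    TTCState S C T where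
  assigned s :=
    if h : pb.OnCycle Ξ master Q σ s ∧ ∃ p, pb.StudentPoints Ξ Q σ s p
    then some h.2.choose else σ.assigned s
  market := pb.remaining Ξ σ

/-- The state after `n` steps. -/
noncomputable def ttcState (pb : Problem S D C T) (Ξ : Set (Distribution C T))
    (master : StrictPref S) (Q : S → StrictPref (C × T)) (n : ℕ) : TTCState S C T :=
  (pb.ttcStep Ξ master Q)^[n] ttcStart

/-- After `n` steps no student remains to be processed. -/
def TTCDoneAt (pb : Problem S D C T) (Ξ : Set (Distribution C T)) (master : StrictPref S)
    (Q : S → StrictPref (C × T)) (n : ℕ) : Prop :=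
  ∀ s, (pb.ttcState Ξ master Q n).assigned s ≠ none

/-- The algorithm terminates. -/
def TTCTerminates (pb : Problem S D C T) (Ξ : Set (Distribution C T)) (master : StrictPref S)
    (Q : S → StrictPref (C × T)) : Prop :=
  ∃ n, pb.TTCDoneAt Ξ master Q n

open Classical in
/-- The outcome of the algorithm at the first time when no student remains to be processed
(and, as a convention, the empty matching if there is no such time). -/
noncomputable def ttcOutcome (pb : Problem S D C T) (Ξ : Set (Distribution C T))
    (master : StrictPref S) (Q : S → StrictPref (C × T)) : Matching S C :=
  if h : pb.TTCTerminates Ξ master Q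
  then fun s => ((pb.ttcState Ξ master Q (Nat.find h)).assigned s).map Prod.fst
  else fun _ => none

/-- The top trading cycles mechanism for the constraint set `Ξ`, the master priority list `master`
and the rule `ext` that turns preferences over schools into orders over school-type pairs. -/
noncomputable def ttc (pb : Problem S D C T) (Ξ : Set (Distribution C T))
    (master : StrictPref S) (ext : S → StrictPref C → StrictPref (C × T)) : Mechanism S C :=
  fun P => pb.ttcOutcome Ξ master (fun s => ext s (P s))

end Problem

end SchoolChoice

/-!
Under the balanced-exchange policy the constraint set is described by a laminar family of counts:
the number of students in each district is prescribed, and the number of students in each school is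
bounded (`mem_exchangePolicy_iff`). Moving one unit between two pairs is therefore admissible
exactly if the districts agree and the receiving school is the same school or has a free seat
(`exchange_mem_iff`). This gives M-convexity, and it shows that permissibility of a student to a
pair `(c, t)` depends only on the school `c` (`Consistent.permissible_iff`).

All pairs that do not point to an owner follow one master list, so two such pairs point to the same
student as soon as each of their students is permissible to the other pair
(`PairPoints.eq_of_permissible`). Two facts about a step follow. Executing all cycles at once
preserves the constraint, because at most one seat of a school with free seats is filled
(`Consistent.ttcStep`). And a pair keeps pointing to the same student until she is on a cycle,
because an arc that changed the load of its school would lead to that same student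
(`Consistent.pairPoints_ttcStep`).

Since the initial pair of an unprocessed student always remains, every step processes somebody, and
students receive pairs of their own type that are no worse than their initial pairs. For constrained
efficiency, look at the first processed student who would get another school at a dominating
matching: that school, or its district, was already filled by processed students, who keep their
places. For strategy-proofness, the runs under two reports of `s` agree until she is processed in
one of them. If the misreport gets her a pair earlier than the truth does, then the path from this
pair to her persists (`Consistent.leadsTo_ttcStep`), and she can still obtain the pair when she is
processed under the truth. If it gets her a pair later, she could have had that pair before, as the
market only shrinks.
-/

namespace SchoolChoice

open Finset Relation

set_option linter.unusedSectionVars false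

/-! ### Strict orders and cycles of relations on finite types -/

namespace StrictPref

variable {A : Type*}

theorem asymm (P : StrictPref A) {a b : A} (h : P.pref a b) : ¬ P.pref b a :=
  fun h' => P.irrefl a (P.trans a b a h h')

theorem exists_best [Finite A] (P : StrictPref A) (s : Set A) (hs : s.Nonempty) :
    ∃ a ∈ s, ∀ b ∈ s, b ≠ a → P.pref a b := by
  have : IsTrans A P.pref := ⟨P.trans⟩
  have : Std.Irrefl P.pref := ⟨P.irrefl⟩
  obtain ⟨a, ha, hmin⟩ := (Finite.wellFounded_of_trans_of_irrefl P.pref).has_min s hs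
  exact ⟨a, ha, fun b hb hne => (P.total a b hne.symm).resolve_right (hmin b hb)⟩

end StrictPref

/-- On a finite type, a relation that can be continued forever inside a nonempty set `U` has a
cycle through a point of `U`. -/
theorem exists_transGen_self {A : Type*} [Finite A] {r : A → A → Prop} {U : Set A}
    (hU : U.Nonempty) (h : ∀ a ∈ U, ∃ b ∈ U, r a b) : ∃ a, TransGen r a a := by
  by_contra! hcon
  have : IsTrans A (fun a b => TransGen r b a) := ⟨fun _ _ _ h₁ h₂ => h₂.trans h₁⟩
  have : Std.Irrefl (fun a b => TransGen r b a) := ⟨hcon⟩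
  obtain ⟨a, ha, hmin⟩ :=
    (Finite.wellFounded_of_trans_of_irrefl (fun a b => TransGen r b a)).has_min U hU
  obtain ⟨b, hb, hab⟩ := h a ha
  exact hmin b hb (.single hab)

theorem transGen_self_of_rel {A : Type*} {r : A → A → Prop}
    (hr : ∀ x y z, r x y → r x z → y = z) {a b : A} (ha : TransGen r a a) (hab : r a b) :
    TransGen r b b := by
  obtain ⟨c, hac, hca⟩ := TransGen.head'_iff.1 ha
  obtain rfl := hr _ _ _ hab hac
  exact .tail' hca hab

theorem exists_rel_transGen_self {A : Type*} {r : A → A → Prop} {a : A} (ha : TransGen r a a) :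
    ∃ b, r b a ∧ TransGen r b b := by
  obtain ⟨c, hac, hca⟩ := TransGen.tail'_iff.1 ha
  exact ⟨c, hca, .head' hca hac⟩

/-- A cycle that avoids `s` survives when only the arcs out of `s` are changed. -/
theorem transGen_self_of_agree_off {A : Type*} {r r' : A → A → Prop} {s a : A}
    (hs : ¬ TransGen r s s) (h : ∀ x y, x ≠ s → r x y → r' x y) (ha : TransGen r a a) :
    TransGen r' a a := by
  suffices H : ∀ b, TransGen r a b → ReflTransGen r b a → TransGen r' a b from H a ha .refl
  intro b hab
  induction hab with
  | single hr =>
    intro hba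
    refine .single (h _ _ ?_ hr)
    rintro rfl
    exact hs (TransGen.head' hr hba)
  | @tail x y hax hxy ih =>
    intro hya
    refine (ih (.head hxy hya)).tail (h _ _ ?_ hxy)
    rintro rfl
    exact hs ((TransGen.head' hxy hya).trans hax)

/-- A path to `s` can be stopped at its first visit to `s`. -/
theorem reflTransGen_stop {A : Type*} {r : A → A → Prop} {s a : A} (h : ReflTransGen r a s) :
    ReflTransGen (fun x y => x ≠ s ∧ r x y) a s := by
  induction h using ReflTransGen.head_induction_on with
  | refl => exact .refl
  | @head x y hxy _ ih =>
    by_cases hx : x = s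
    · rw [hx]
    · exact .head ⟨hx, hxy⟩ ih

/-! ### Distributions and the balanced-exchange constraint -/

section Mass

variable {S C T : Type*} [Fintype S] [Fintype C] [Fintype T]

open Classical in
/-- The number of students that the distribution `ξ` places in the schools satisfying `φ`. -/
noncomputable def mass (ξ : Distribution C T) (φ : C → Prop) : ℕ :=
  ∑ t, ∑ c with φ c, ξ (c, t)

theorem mass_add (ξ η : Distribution C T) (φ : C → Prop) :
    mass (ξ + η) φ = mass ξ φ + mass η φ := by
  simp [mass, sum_add_distrib]

open Classical in
theorem mass_chi (p : C × T) (φ : C → Prop) :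
    mass (chi p) φ = if φ p.1 then 1 else 0 := by
  obtain ⟨c, t⟩ := p
  simp only [mass, chi, Prod.mk.injEq]
  rw [Finset.sum_eq_single t]
  · simp only [and_true]
    rw [Finset.sum_ite_eq']
    simp
  · intro b _ hb
    simp [hb]
  · simp

open Classical in
theorem mass_eq_school (ξ : Distribution C T) (c : C) :
    mass ξ (· = c) = ∑ t, ξ (c, t) := by
  simp only [mass]
  refine Finset.sum_congr rfl fun t _ => ?_
  rw [Finset.sum_filter, Finset.sum_ite_eq' univ c]
  simp

/-- The distribution of an assignment of students to school-type pairs. -/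
noncomputable def pairDist (g : S → C × T) : Distribution C T :=
  fun p => Nat.card {s : S // g s = p}

open Classical in
theorem mass_pairDist (g : S → C × T) (φ : C → Prop) :
    mass (pairDist g) φ = #{s | φ (g s).1} := by
  have h1 : ∀ p, pairDist g p = ∑ s, chi (g s) p := by
    intro p
    simp only [pairDist, chi, Nat.card_eq_fintype_card, Fintype.card_subtype, card_filter]
    exact sum_congr rfl fun s _ => by simp only [eq_comm]
  have h2 : mass (pairDist g) φ = ∑ s, mass (chi (g s)) φ := by
    simp only [mass, h1]
    rw [sum_comm (s := (univ : Finset S))]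
    exact sum_congr rfl fun t _ => sum_comm
  rw [h2, card_filter]
  exact sum_congr rfl fun s _ => mass_chi _ _

end Mass

theorem chi_self {C T : Type*} (p : C × T) : (chi p : Distribution C T) p = 1 := by
  simp [chi]

theorem chi_le {C T : Type*} {ξ : Distribution C T} {p : C × T} (h : 0 < ξ p) : chi p ≤ ξ := by
  intro p'
  by_cases hp : p' = p
  · subst hp; rw [chi_self]; exact h
  · simp [chi, hp]

namespace Problem

variable {S D C T : Type*} [Fintype S] [Fintype D] [Fintype C] [Fintype T]

/-- The constraint set of the mechanism: balanced exchange, every student matched, and no school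
above its capacity. -/
abbrev exchangePolicy (pb : Problem S D C T) : Set (Distribution C T) :=
  pb.balancedPolicy ∩ pb.policyZero

/-- Balance of every district already forces that all students are matched. -/
theorem mem_exchangePolicy_iff (pb : Problem S D C T) (ξ : Distribution C T) :
    ξ ∈ pb.exchangePolicy ↔
      (∀ d, mass ξ (fun c => pb.district c = d) = pb.numHome d) ∧
        ∀ c, mass ξ (· = c) ≤ pb.cap c := by
  classical
  simp only [mass_eq_school]
  constructor
  · rintro ⟨h1, -, h2⟩
    exact ⟨h1, h2⟩
  · rintro ⟨h1, h2⟩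
    refine ⟨h1, ?_, h2⟩
    simp only [← h1, mass]
    rw [sum_comm, sum_comm (s := (univ : Finset D))]
    refine sum_congr rfl fun t _ => ?_
    rw [← sum_fiberwise (s := univ) (g := pb.district)]

/-- Moving one unit from the pair `q` to the pair `p` keeps the constraint exactly if both lie in
the same district and the school of `p` either is the school of `q` or has a free seat. -/
theorem exchange_mem_iff (pb : Problem S D C T) {ξ η : Distribution C T} {p q : C × T}
    (hξ : ξ ∈ pb.exchangePolicy) (h : η + chi q = ξ + chi p) :
    η ∈ pb.exchangePolicy ↔ pb.district p.1 = pb.district q.1 ∧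
      (p.1 = q.1 ∨ mass ξ (· = p.1) < pb.cap p.1) := by
  classical
  have key : ∀ φ : C → Prop, mass η φ + (if φ q.1 then 1 else 0) =
      mass ξ φ + (if φ p.1 then 1 else 0) := by
    intro φ
    rw [← mass_chi, ← mass_chi, ← mass_add, ← mass_add, h]
  rw [mem_exchangePolicy_iff] at hξ ⊢
  obtain ⟨hd, hc⟩ := hξ
  constructor
  · rintro ⟨hd', hc'⟩
    constructor
    · have := key (fun c => pb.district c = pb.district p.1)
      rw [hd, hd'] at this
      by_contra hne
      simp [Ne.symm hne] at this
    · by_contra! hcon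
      have h1 := key (· = p.1)
      have h2 := hc' p.1
      simp only [hcon.1.symm, if_true, if_false] at h1
      omega
  · rintro ⟨h1, h2⟩
    constructor
    · intro d
      have := key (fun c => pb.district c = d)
      rw [h1] at this
      rw [← hd]
      omega
    · intro c
      have h3 := key (· = c)
      have h4 := hc c
      by_cases hp : p.1 = c
      · subst hp
        rcases h2 with h2 | h2
        · simp only [h2] at *
          omega
        · split_ifs at h3 <;> omega
      · rw [if_neg hp] at h3
        omega

/-- If `ξ` exceeds `ξ'` at `p`, there is a pair `p'` where `ξ` falls short of `ξ'`: in the same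
school when that school is not fuller at `ξ` than at `ξ'`, and otherwise in a less full school of
the same district. -/
theorem mConvex_exchangePolicy (pb : Problem S D C T) : MConvex pb.exchangePolicy := by
  classical
  intro ξ hξ ξ' hξ' p hp
  have hmem : ∀ p' : C × T, ξ p' < ξ' p' → pb.district p'.1 = pb.district p.1 →
      (p'.1 = p.1 ∨ mass ξ (· = p'.1) < mass ξ' (· = p'.1) ∧
        mass ξ' (· = p.1) < mass ξ (· = p.1)) →
      (ξ - chi p) + chi p' ∈ pb.exchangePolicy ∧ (ξ' + chi p) - chi p' ∈ pb.exchangePolicy := by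
    intro p' hp' hdis hor
    have h1 : (ξ - chi p) + chi p' + chi p = ξ + chi p' := by
      rw [add_right_comm, tsub_add_cancel_of_le (chi_le (by omega))]
    have h2 : (ξ' + chi p) - chi p' + chi p' = ξ' + chi p :=
      tsub_add_cancel_of_le ((chi_le (by omega)).trans le_self_add)
    have hc := ((pb.mem_exchangePolicy_iff ξ).1 hξ).2
    have hc' := ((pb.mem_exchangePolicy_iff ξ').1 hξ').2
    rw [pb.exchange_mem_iff hξ h1, pb.exchange_mem_iff hξ' h2]
    refine ⟨⟨hdis, ?_⟩, ⟨hdis.symm, ?_⟩⟩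
    · exact hor.imp id fun h => h.1.trans_le (hc' _)
    · exact hor.imp Eq.symm fun h => h.2.trans_le (hc _)
  by_cases hle : mass ξ (· = p.1) ≤ mass ξ' (· = p.1)
  · rw [mass_eq_school, mass_eq_school] at hle
    obtain ⟨t, ht⟩ : ∃ t, ξ (p.1, t) < ξ' (p.1, t) := by
      by_contra! hcon
      exact absurd hle (not_le.2 (sum_lt_sum (fun t _ => hcon t) ⟨p.2, mem_univ _, hp⟩))
    exact ⟨(p.1, t), ht, hmem _ ht rfl (.inl rfl)⟩
  · push Not at hle
    obtain ⟨c, hcd, hc⟩ : ∃ c, pb.district c = pb.district p.1 ∧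
        mass ξ (· = c) < mass ξ' (· = c) := by
      by_contra! hcon
      have hd := ((pb.mem_exchangePolicy_iff ξ).1 hξ).1 (pb.district p.1)
      have hd' := ((pb.mem_exchangePolicy_iff ξ').1 hξ').1 (pb.district p.1)
      simp only [mass_eq_school] at hcon hle
      rw [mass, sum_comm] at hd hd'
      have : ∑ c with pb.district c = pb.district p.1, ∑ t, ξ' (c, t) <
          ∑ c with pb.district c = pb.district p.1, ∑ t, ξ (c, t) :=
        sum_lt_sum (fun c hc => hcon c (by simpa using hc)) ⟨p.1, by simp, hle⟩
      omega
    obtain ⟨t, ht⟩ : ∃ t, ξ (c, t) < ξ' (c, t) := by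
      by_contra! hcon
      rw [mass_eq_school, mass_eq_school] at hc
      exact absurd hc (not_lt.2 (sum_le_sum fun t _ => hcon t))
    exact ⟨(c, t), ht, hmem _ ht hcd (.inr ⟨hc, hle⟩)⟩

/-! ### Permissibility and pointing -/

/-- The invariant of the algorithm: the current distribution satisfies the constraint, and the
initial pairs of the unprocessed students are still in the market. -/
structure Consistent (pb : Problem S D C T) (σ : TTCState S C T) : Prop where
  dist_mem : pb.currentDist σ ∈ pb.exchangePolicy
  init_mem : ∀ s, σ.assigned s = none → pb.initPair s ∈ σ.market

/-- The number of students currently at the schools satisfying `φ`, an unprocessed student being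
counted at her initial school. -/
noncomputable abbrev load (pb : Problem S D C T) (σ : TTCState S C T) (φ : C → Prop) : ℕ :=
  mass (pb.currentDist σ) φ

section Pointing

variable {pb : Problem S D C T} {master : StrictPref S} {Q : S → StrictPref (C × T)}
  {σ : TTCState S C T} {Ξ : Set (Distribution C T)}

open Classical in
theorem load_eq_card (φ : C → Prop) :
    pb.load σ φ = #{s | φ (pb.currentPair σ s).1} :=
  mass_pairDist (pb.currentPair σ) φ

theorem currentPair_of_unassigned {s : S} (h : σ.assigned s = none) :
    pb.currentPair σ s = pb.initPair s := by
  simp [currentPair, h]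

/-- Whether a student is permissible to a pair `(c, t)` depends only on the school `c`: it has to
be her initial school, or a school of the same district with a free seat. -/
theorem Consistent.permissible_iff (h : pb.Consistent σ) {s : S} {p : C × T} :
    pb.Permissible pb.exchangePolicy σ s p ↔ σ.assigned s = none ∧
      pb.district p.1 = pb.district (pb.init s) ∧
        (p.1 = pb.init s ∨ pb.load σ (· = p.1) < pb.cap p.1) := by
  refine and_congr_right fun hs => pb.exchange_mem_iff (q := pb.initPair s) h.dist_mem ?_
  refine tsub_add_cancel_of_le ((chi_le ?_).trans le_self_add)
  have : Nonempty {s' // pb.currentPair σ s' = pb.initPair s} :=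
    ⟨s, currentPair_of_unassigned hs⟩
  exact Nat.card_pos

theorem Consistent.permissible_init (h : pb.Consistent σ) {s : S} {p : C × T}
    (hs : σ.assigned s = none) (hp : pb.init s = p.1) :
    pb.Permissible pb.exchangePolicy σ s p :=
  h.permissible_iff.2 ⟨hs, by rw [hp], .inl hp.symm⟩

theorem Consistent.initPair_mem_remaining (h : pb.Consistent σ) {s : S}
    (hs : σ.assigned s = none) : pb.initPair s ∈ pb.remaining pb.exchangePolicy σ :=
  ⟨h.init_mem s hs, s, h.permissible_init hs rfl⟩

/-- The priority order of the pair `p`. -/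
def priority (pb : Problem S D C T) (master : StrictPref S) (p : C × T) : StrictPref S where
  pref := pb.HigherPriority master p
  irrefl a := by
    rintro (⟨h, h'⟩ | ⟨-, h⟩)
    · exact h' h
    · exact master.irrefl a h
  trans a b c := by
    have := master.trans a b c
    simp only [HigherPriority]
    tauto
  total a b hab := by
    have := master.total a b hab
    simp only [HigherPriority]
    tauto

theorem exists_pairPoints {p : C × T} (hp : p ∈ pb.remaining Ξ σ) :
    ∃ s, pb.PairPoints Ξ master σ p s := by
  obtain ⟨s, hs, hbest⟩ :=
    (pb.priority master p).exists_best {s | pb.Permissible Ξ σ s p} hp.2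
  exact ⟨s, hp, hs, hbest⟩

theorem Consistent.exists_studentPoints (h : pb.Consistent σ) {s : S}
    (hs : σ.assigned s = none) : ∃ p, pb.StudentPoints pb.exchangePolicy Q σ s p := by
  obtain ⟨p, hp, hbest⟩ := (Q s).exists_best _ ⟨_, h.initPair_mem_remaining hs⟩
  exact ⟨p, hs, hp, hbest⟩

theorem PairPoints.unique {p : C × T} {s s' : S} (h : pb.PairPoints Ξ master σ p s)
    (h' : pb.PairPoints Ξ master σ p s') : s = s' := by
  by_contra hne
  exact (pb.priority master p).asymm (h.2.2 s' h'.2.1 (Ne.symm hne)) (h'.2.2 s h.2.1 hne)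

theorem StudentPoints.unique {s : S} {p p' : C × T} (h : pb.StudentPoints Ξ Q σ s p)
    (h' : pb.StudentPoints Ξ Q σ s p') : p = p' := by
  by_contra hne
  exact (Q s).asymm (h.2.2 p' h'.2.1 (Ne.symm hne)) (h'.2.2 p h.2.1 hne)

/-- Two pairs that both follow the master list, because neither points to an owner, point to the
same student as soon as each of the two students is permissible to the other pair. -/
theorem PairPoints.eq_of_permissible {p p' : C × T} {b b' : S}
    (h : pb.PairPoints Ξ master σ p b) (h' : pb.PairPoints Ξ master σ p' b')
    (hb : pb.initPair b ≠ p) (hb' : pb.initPair b' ≠ p')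
    (hbp' : pb.Permissible Ξ σ b p') (hb'p : pb.Permissible Ξ σ b' p) : b = b' := by
  by_contra hne
  have h1 := h.2.2 b' hb'p (Ne.symm hne)
  have h2 := h'.2.2 b hbp' hne
  simp only [HigherPriority, hb, hb', false_and, false_or] at h1 h2
  exact master.asymm h1.2 h2.2

/-- Student `a` points to a pair that points to student `b`. -/
def Arc (pb : Problem S D C T) (Ξ : Set (Distribution C T)) (master : StrictPref S)
    (Q : S → StrictPref (C × T)) (σ : TTCState S C T) (a b : S) : Prop :=
  ∃ p, pb.StudentPoints Ξ Q σ a p ∧ pb.PairPoints Ξ master σ p b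

theorem Arc.unique {a b c : S} (hb : pb.Arc Ξ master Q σ a b) (hc : pb.Arc Ξ master Q σ a c) :
    b = c := by
  obtain ⟨p, hap, hpb⟩ := hb
  obtain ⟨q, haq, hqc⟩ := hc
  obtain rfl := hap.unique haq
  exact hpb.unique hqc

theorem OnCycle.of_arc {a b : S} (h : pb.OnCycle Ξ master Q σ a)
    (hab : pb.Arc Ξ master Q σ a b) : pb.OnCycle Ξ master Q σ b :=
  transGen_self_of_rel (r := pb.Arc Ξ master Q σ) (fun _ _ _ => Arc.unique) h hab

theorem OnCycle.exists_studentPoints {a : S} (h : pb.OnCycle Ξ master Q σ a) :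
    ∃ p, pb.StudentPoints Ξ Q σ a p := by
  obtain ⟨_, ⟨p, hp, -⟩, -⟩ := TransGen.head'_iff.1 h
  exact ⟨p, hp⟩

theorem OnCycle.unassigned {a : S} (h : pb.OnCycle Ξ master Q σ a) : σ.assigned a = none := by
  obtain ⟨p, hp⟩ := h.exists_studentPoints
  exact hp.1

theorem Consistent.exists_onCycle (h : pb.Consistent σ) {s : S} (hs : σ.assigned s = none) :
    ∃ a, pb.OnCycle pb.exchangePolicy master Q σ a := by
  refine exists_transGen_self (U := {s | σ.assigned s = none}) ⟨s, hs⟩ fun a ha => ?_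
  obtain ⟨p, hp⟩ := h.exists_studentPoints (Q := Q) ha
  obtain ⟨b, hb⟩ := exists_pairPoints (master := master) hp.2.1
  exact ⟨b, hb.2.1.1, p, hp, hb⟩

/-! ### One step of the algorithm -/

theorem ttcStep_assigned_of_onCycle {s : S} {p : C × T} (h : pb.OnCycle Ξ master Q σ s)
    (hp : pb.StudentPoints Ξ Q σ s p) : (pb.ttcStep Ξ master Q σ).assigned s = some p := by
  have hex : ∃ p, pb.StudentPoints Ξ Q σ s p := ⟨p, hp⟩
  simp only [ttcStep]
  rw [dif_pos ⟨h, hex⟩]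
  exact congrArg some (hex.choose_spec.unique hp)

theorem ttcStep_assigned_of_not_onCycle {s : S} (h : ¬ pb.OnCycle Ξ master Q σ s) :
    (pb.ttcStep Ξ master Q σ).assigned s = σ.assigned s := by
  simp only [ttcStep]
  rw [dif_neg fun h' => h h'.1]

theorem ttcStep_assigned_eq_none_iff {s : S} :
    (pb.ttcStep Ξ master Q σ).assigned s = none ↔
      σ.assigned s = none ∧ ¬ pb.OnCycle Ξ master Q σ s := by
  by_cases h : pb.OnCycle Ξ master Q σ s
  · obtain ⟨p, hp⟩ := h.exists_studentPoints
    simp [ttcStep_assigned_of_onCycle h hp, h]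
  · simp [ttcStep_assigned_of_not_onCycle h, h]

theorem ttcStep_assigned_of_eq_some {s : S} {p : C × T} (h : σ.assigned s = some p) :
    (pb.ttcStep Ξ master Q σ).assigned s = some p := by
  rw [ttcStep_assigned_of_not_onCycle, h]
  intro hc
  simp [hc.unassigned] at h

open Classical in
/-- The students on cycles are permuted by "the student pointed to by the pair that I point to".
Executing the cycles therefore replaces, in every count of students per group of schools, the
initial schools of the successors by the schools of the pairs that point to them. -/
theorem exists_cycle_successor (pb : Problem S D C T) (Ξ : Set (Distribution C T))
    (master : StrictPref S) (Q : S → StrictPref (C × T)) (σ : TTCState S C T) :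
    ∃ (tgt : S → C × T) (next : S → S),
      (∀ a, pb.OnCycle Ξ master Q σ a → pb.StudentPoints Ξ Q σ a (tgt a) ∧
        pb.PairPoints Ξ master σ (tgt a) (next a) ∧ pb.OnCycle Ξ master Q σ (next a)) ∧
      (∀ a b, pb.OnCycle Ξ master Q σ a → pb.OnCycle Ξ master Q σ b → next a = next b → a = b) ∧
      ∀ φ : C → Prop, pb.load (pb.ttcStep Ξ master Q σ) φ +
          #{a | pb.OnCycle Ξ master Q σ a ∧ φ (pb.init (next a))} =
        pb.load σ φ + #{a | pb.OnCycle Ξ master Q σ a ∧ φ (tgt a).1} := by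
  have hex : ∀ a, ∃ (p : C × T) (b : S), pb.OnCycle Ξ master Q σ a →
      pb.StudentPoints Ξ Q σ a p ∧ pb.PairPoints Ξ master σ p b := by
    intro a
    by_cases ha : pb.OnCycle Ξ master Q σ a
    · obtain ⟨b, ⟨p, hp, hb⟩, -⟩ := TransGen.head'_iff.1 ha
      exact ⟨p, b, fun _ => ⟨hp, hb⟩⟩
    · exact ⟨pb.initPair a, a, fun h => absurd h ha⟩
  choose tgt next hpt using hex
  have hcyc : ∀ a, pb.OnCycle Ξ master Q σ a → pb.OnCycle Ξ master Q σ (next a) :=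
    fun a ha => ha.of_arc ⟨_, hpt a ha⟩
  have hsurj : ∀ b, pb.OnCycle Ξ master Q σ b →
      ∃ a, pb.OnCycle Ξ master Q σ a ∧ next a = b := by
    intro b hb
    obtain ⟨a, hab, ha⟩ := exists_rel_transGen_self hb
    exact ⟨a, ha, Arc.unique ⟨_, hpt a ha⟩ hab⟩
  have hinj : ∀ a b, pb.OnCycle Ξ master Q σ a → pb.OnCycle Ξ master Q σ b →
      next a = next b → a = b := by
    have himage : image next {a | pb.OnCycle Ξ master Q σ a} =
        ({a | pb.OnCycle Ξ master Q σ a} : Finset S) := by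
      ext b
      simp only [mem_image, mem_filter, mem_univ, true_and]
      exact ⟨fun ⟨a, ha, hab⟩ => hab ▸ hcyc a ha, hsurj b⟩
    have := card_image_iff.1 (congrArg card himage)
    intro a b ha hb
    exact this (by simpa using ha) (by simpa using hb)
  refine ⟨tgt, next, fun a ha => ⟨(hpt a ha).1, (hpt a ha).2, hcyc a ha⟩, hinj, fun φ => ?_⟩
  have hshift : #{a | pb.OnCycle Ξ master Q σ a ∧ φ (pb.init (next a))} =
      #{a | pb.OnCycle Ξ master Q σ a ∧ φ (pb.currentPair σ a).1} := by
    refine card_bij (fun a _ => next a) ?_ ?_ ?_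
    · intro a ha
      simp only [mem_filter, mem_univ, true_and] at ha ⊢
      refine ⟨hcyc a ha.1, ?_⟩
      rw [currentPair_of_unassigned (hcyc a ha.1).unassigned]
      exact ha.2
    · intro a ha b hb
      simp only [mem_filter, mem_univ, true_and] at ha hb
      exact hinj a b ha.1 hb.1
    · intro b hb
      simp only [mem_filter, mem_univ, true_and] at hb
      obtain ⟨a, ha, rfl⟩ := hsurj b hb.1
      refine ⟨a, ?_, rfl⟩
      have := hb.2
      rw [currentPair_of_unassigned hb.1.unassigned] at this
      simpa using ⟨ha, this⟩
  have hsplit : ∀ g : S → C × T, #{s | φ (g s).1} =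
      #{s | pb.OnCycle Ξ master Q σ s ∧ φ (g s).1} +
        #{s | ¬ pb.OnCycle Ξ master Q σ s ∧ φ (g s).1} := by
    intro g
    rw [← card_filter_add_card_filter_not (s := {s | φ (g s).1}) (pb.OnCycle Ξ master Q σ),
      filter_filter, filter_filter]
    simp only [and_comm]
  have htgt : #{s | pb.OnCycle Ξ master Q σ s ∧
        φ (pb.currentPair (pb.ttcStep Ξ master Q σ) s).1} =
      #{s | pb.OnCycle Ξ master Q σ s ∧ φ (tgt s).1} := by
    refine congrArg card (filter_congr fun s _ => and_congr_right fun hs => ?_)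
    simp [currentPair, ttcStep_assigned_of_onCycle hs (hpt s hs).1]
  have hstay : #{s | ¬ pb.OnCycle Ξ master Q σ s ∧
        φ (pb.currentPair (pb.ttcStep Ξ master Q σ) s).1} =
      #{s | ¬ pb.OnCycle Ξ master Q σ s ∧ φ (pb.currentPair σ s).1} := by
    refine congrArg card (filter_congr fun s _ => and_congr_right fun hs => ?_)
    simp [currentPair, ttcStep_assigned_of_not_onCycle hs]
  rw [load_eq_card, load_eq_card, hsplit, hsplit (pb.currentPair σ), hshift, htgt, hstay]
  omega

/-- Executing all cycles at once preserves the constraint. Balance is kept because a pair and the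
student it points to belong to the same district. A full school only points to its own initial
students, and at a school with a free seat all pairs that do not point to an initial student of the
school point to the same student, so that at most one seat is filled. -/
theorem Consistent.ttcStep (h : pb.Consistent σ) :
    pb.Consistent (pb.ttcStep pb.exchangePolicy master Q σ) := by
  classical
  refine ⟨?_, fun s hs => h.initPair_mem_remaining (ttcStep_assigned_eq_none_iff.1 hs).1⟩
  obtain ⟨tgt, next, hpt, hinj, hload⟩ :=
    exists_cycle_successor pb pb.exchangePolicy master Q σ
  obtain ⟨hd, hc⟩ := (pb.mem_exchangePolicy_iff _).1 h.dist_mem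
  have hperm := fun a ha => h.permissible_iff.1 (hpt a ha).2.1.2.1
  refine (pb.mem_exchangePolicy_iff _).2 ⟨fun d => ?_, fun c => ?_⟩
  · rw [← hd d]
    have hcard : #{a | pb.OnCycle pb.exchangePolicy master Q σ a ∧
          pb.district (pb.init (next a)) = d} =
        #{a | pb.OnCycle pb.exchangePolicy master Q σ a ∧ pb.district (tgt a).1 = d} :=
      congrArg card (filter_congr fun a _ => and_congr_right fun ha => by rw [(hperm a ha).2.1])
    have := hload (fun c => pb.district c = d)
    change pb.load _ _ = pb.load _ _
    omega
  · have hstep := hload (· = c)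
    have hcap : pb.load σ (· = c) ≤ pb.cap c := hc c
    rcases hcap.eq_or_lt with hfull | hfree
    · have hsub : #{a | pb.OnCycle pb.exchangePolicy master Q σ a ∧ (tgt a).1 = c} ≤
          #{a | pb.OnCycle pb.exchangePolicy master Q σ a ∧ pb.init (next a) = c} := by
        refine card_le_card fun a => ?_
        simp only [mem_filter, mem_univ, true_and]
        rintro ⟨ha, rfl⟩
        exact ⟨ha, ((hperm a ha).2.2.resolve_right (by omega)).symm⟩
      change pb.load _ _ ≤ _
      omega
    · have hone : #{a | pb.OnCycle pb.exchangePolicy master Q σ a ∧ (tgt a).1 = c ∧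
          pb.init (next a) ≠ c} ≤ 1 := by
        refine card_le_one.2 fun a ha a' ha' => ?_
        simp only [mem_filter, mem_univ, true_and] at ha ha'
        obtain ⟨ha, rfl, hne⟩ := ha
        obtain ⟨ha', htt, hne'⟩ := ha'
        have h1 := hperm a ha
        have h2 := hperm a' ha'
        refine hinj a a' ha ha' ((hpt a ha).2.1.eq_of_permissible (hpt a' ha').2.1
          (fun he => hne (congrArg Prod.fst he))
          (fun he => hne' ((congrArg Prod.fst he).trans htt))
          (h.permissible_iff.2 ?_) (h.permissible_iff.2 ?_))
        · rw [htt]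
          exact h1
        · rw [← htt]
          exact h2
      have hsub : #{a | pb.OnCycle pb.exchangePolicy master Q σ a ∧ (tgt a).1 = c} ≤
          #{a | pb.OnCycle pb.exchangePolicy master Q σ a ∧ pb.init (next a) = c} +
          #{a | pb.OnCycle pb.exchangePolicy master Q σ a ∧ (tgt a).1 = c ∧
            pb.init (next a) ≠ c} := by
        refine (card_le_card fun a => ?_).trans (card_union_le _ _)
        simp only [mem_union, mem_filter, mem_univ, true_and]
        tauto
      change pb.load _ _ ≤ _
      omega

/-- If a pair `p` points to a student `b` who does not own it and is not on a cycle, the load of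
its school does not change: an executed arc that fills or frees a seat of that school would,
like `p`, follow the master list within the same district, and hence lead to `b`. -/
theorem Consistent.load_ttcStep_eq (h : pb.Consistent σ) {p : C × T} {b : S}
    (hp : pb.PairPoints pb.exchangePolicy master σ p b) (hown : pb.initPair b ≠ p)
    (hb : ¬ pb.OnCycle pb.exchangePolicy master Q σ b) :
    pb.load (pb.ttcStep pb.exchangePolicy master Q σ) (· = p.1) = pb.load σ (· = p.1) := by
  classical
  obtain ⟨tgt, next, hpt, -, hload⟩ :=
    exists_cycle_successor pb pb.exchangePolicy master Q σ
  have hb' := h.permissible_iff.1 hp.2.1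
  suffices hcard : #{a | pb.OnCycle pb.exchangePolicy master Q σ a ∧ pb.init (next a) = p.1} =
      #{a | pb.OnCycle pb.exchangePolicy master Q σ a ∧ (tgt a).1 = p.1} by
    have := hload (· = p.1)
    omega
  refine congrArg card (filter_congr fun a _ => and_congr_right fun ha => ?_)
  obtain ⟨-, hpa, hcyc⟩ := hpt a ha
  have ha' := h.permissible_iff.1 hpa.2.1
  have hne : b ≠ next a := fun he => hb (he ▸ hcyc)
  constructor
  · intro hinit
    by_contra htgt
    have hfree := ha'.2.2.resolve_left (by rw [hinit]; exact htgt)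
    refine hne (hp.eq_of_permissible hpa hown (fun he => htgt ?_)
      (h.permissible_iff.2 ⟨hb'.1, ?_, .inr hfree⟩) (h.permissible_init ha'.1 hinit))
    · rw [← hinit, ← he, initPair]
    · rw [ha'.2.1, hinit, hb'.2.1]
  · intro htgt
    by_contra hinit
    refine hne (hp.eq_of_permissible hpa hown (fun he => hinit ?_)
      (h.permissible_iff.2 ?_) (h.permissible_iff.2 ?_))
    · rw [← htgt, ← he, initPair]
    · rw [htgt]
      exact hb'
    · rw [← htgt]
      exact ha'

/-- A pair keeps pointing to the same student until she is on a cycle. -/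
theorem Consistent.pairPoints_ttcStep (h : pb.Consistent σ) {p : C × T} {b : S}
    (hp : pb.PairPoints pb.exchangePolicy master σ p b)
    (hb : ¬ pb.OnCycle pb.exchangePolicy master Q σ b) :
    pb.PairPoints pb.exchangePolicy master (pb.ttcStep pb.exchangePolicy master Q σ) p b := by
  have h' := h.ttcStep (master := master) (Q := Q)
  have hbn := ttcStep_assigned_eq_none_iff.2 ⟨hp.2.1.1, hb⟩
  by_cases hown : pb.initPair b = p
  · have hbp := h'.permissible_init hbn (congrArg Prod.fst hown)
    refine ⟨⟨hp.1, b, hbp⟩, hbp, fun s hs hne => ?_⟩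
    by_cases hsp : pb.initPair s = p
    · exact hp.2.2 s (h.permissible_init (ttcStep_assigned_eq_none_iff.1 hs.1).1
        (congrArg Prod.fst hsp)) hne
    · exact .inl ⟨hown, hsp⟩
  · have hload := h.load_ttcStep_eq hp hown hb
    have hiff : ∀ s, pb.Permissible pb.exchangePolicy
        (pb.ttcStep pb.exchangePolicy master Q σ) s p ↔
        (pb.Permissible pb.exchangePolicy σ s p ∧
          ¬ pb.OnCycle pb.exchangePolicy master Q σ s) := by
      intro s
      rw [h.permissible_iff, h'.permissible_iff, hload, ttcStep_assigned_eq_none_iff]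
      tauto
    have hbp := (hiff b).2 ⟨hp.2.1, hb⟩
    exact ⟨⟨hp.1, b, hbp⟩, hbp, fun s hs hne => hp.2.2 s ((hiff s).1 hs).1 hne⟩

theorem StudentPoints.ttcStep {a : S} {p : C × T} (h : pb.StudentPoints Ξ Q σ a p)
    (ha : ¬ pb.OnCycle Ξ master Q σ a)
    (hp : p ∈ pb.remaining Ξ (pb.ttcStep Ξ master Q σ)) :
    pb.StudentPoints Ξ Q (pb.ttcStep Ξ master Q σ) a p :=
  ⟨ttcStep_assigned_eq_none_iff.2 ⟨h.1, ha⟩, hp, fun p' hp' hne => h.2.2 p' hp'.1 hne⟩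

/-- The pair `p` points to `s`, or to the start of a path of students that ends at `s`. -/
def LeadsTo (pb : Problem S D C T) (Ξ : Set (Distribution C T)) (master : StrictPref S)
    (Q : S → StrictPref (C × T)) (σ : TTCState S C T) (p : C × T) (s : S) : Prop :=
  ∃ b, pb.PairPoints Ξ master σ p b ∧
    ReflTransGen (fun x y => x ≠ s ∧ pb.Arc Ξ master Q σ x y) b s

/-- Paths to a student who is not on a cycle persist. -/
theorem Consistent.leadsTo_ttcStep (h : pb.Consistent σ) {p : C × T} {s : S}
    (hp : pb.LeadsTo pb.exchangePolicy master Q σ p s)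
    (hs : ¬ pb.OnCycle pb.exchangePolicy master Q σ s) :
    pb.LeadsTo pb.exchangePolicy master Q (pb.ttcStep pb.exchangePolicy master Q σ) p s := by
  obtain ⟨b, hpb, hpath⟩ := hp
  suffices H : ¬ pb.OnCycle pb.exchangePolicy master Q σ b ∧
      ReflTransGen (fun x y => x ≠ s ∧ pb.Arc pb.exchangePolicy master Q
        (pb.ttcStep pb.exchangePolicy master Q σ) x y) b s from
    ⟨b, h.pairPoints_ttcStep hpb H.1, H.2⟩
  clear hpb
  induction hpath using ReflTransGen.head_induction_on with
  | refl => exact ⟨hs, .refl⟩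
  | @head x y hxy _ ih =>
    have hx : ¬ pb.OnCycle pb.exchangePolicy master Q σ x := fun hx => ih.1 (hx.of_arc hxy.2)
    obtain ⟨hne, q, hxq, hqy⟩ := hxy
    have hqy' := h.pairPoints_ttcStep hqy ih.1
    exact ⟨hx, .head ⟨hne, q, hxq.ttcStep hx hqy'.1, hqy'⟩ ih.2⟩

/-- A change of the preferences of `s` alone is without effect while `s` is on no cycle. -/
theorem ttcStep_congr {Q' : S → StrictPref (C × T)} {s : S} (hQ : ∀ u, u ≠ s → Q u = Q' u)
    (hs : ¬ pb.OnCycle Ξ master Q σ s) (hs' : ¬ pb.OnCycle Ξ master Q' σ s) :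
    pb.ttcStep Ξ master Q σ = pb.ttcStep Ξ master Q' σ := by
  have hiff : ∀ a, pb.OnCycle Ξ master Q σ a ↔ pb.OnCycle Ξ master Q' σ a := by
    intro a
    constructor
    · refine transGen_self_of_agree_off hs fun x y hx => ?_
      simp only [StudentPoints, hQ x hx, imp_self]
    · refine transGen_self_of_agree_off hs' fun x y hx => ?_
      simp only [StudentPoints, hQ x hx, imp_self]
  have hassigned : (pb.ttcStep Ξ master Q σ).assigned = (pb.ttcStep Ξ master Q' σ).assigned := by
    funext a
    by_cases ha : pb.OnCycle Ξ master Q σ a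
    · obtain ⟨p, hp⟩ := ha.exists_studentPoints
      have hp' : pb.StudentPoints Ξ Q' σ a p := by
        have hne : a ≠ s := by
          rintro rfl
          exact hs ha
        simpa only [StudentPoints, hQ a hne] using hp
      rw [ttcStep_assigned_of_onCycle ha hp, ttcStep_assigned_of_onCycle ((hiff a).1 ha) hp']
    · rw [ttcStep_assigned_of_not_onCycle ha,
        ttcStep_assigned_of_not_onCycle fun h => ha ((hiff a).2 h)]
  exact congrArg (fun f => TTCState.mk f (pb.remaining Ξ σ)) hassigned

theorem StudentPoints.eq_or_pref {a : S} {p p' : C × T} (h : pb.StudentPoints Ξ Q σ a p)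
    (hp' : p' ∈ pb.remaining Ξ σ) : p = p' ∨ (Q a).pref p p' := by
  by_cases he : p' = p
  · exact .inl he.symm
  · exact .inr (h.2.2 p' hp' he)

/-- Students only point to pairs with their own type, since their initial pair remains. -/
theorem StudentPoints.snd_eq {a : S} {p : C × T} {P : StrictPref C}
    (h : pb.StudentPoints pb.exchangePolicy Q σ a p) (hσ : pb.Consistent σ)
    (hQ : pb.IsPairPref a P (Q a)) : p.2 = pb.type a := by
  by_contra hne
  have h1 := hQ.2 p.1 p.2 hne
  rcases h.eq_or_pref (hσ.initPair_mem_remaining h.1) with rfl | h2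
  · exact hne rfl
  · exact (Q a).asymm h1 h2

end Pointing

/-! ### The run of the algorithm -/

section Run

variable {pb : Problem S D C T} {master : StrictPref S} {Q : S → StrictPref (C × T)}
  {Ξ : Set (Distribution C T)}

theorem ttcState_succ (n : ℕ) :
    pb.ttcState Ξ master Q (n + 1) = pb.ttcStep Ξ master Q (pb.ttcState Ξ master Q n) :=
  Function.iterate_succ_apply' _ _ _

/-- The distribution of a matching that leaves nobody unmatched. -/
theorem dist_eq_pairDist {X : Matching S C} {x : S → C × T} (h : ∀ s, X s = some (x s).1)
    (h' : ∀ s, (x s).2 = pb.type s) : pb.dist X = pairDist x := by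
  funext p
  refine Nat.card_congr (Equiv.subtypeEquivRight fun s => ?_)
  rw [h, ← h', Option.some_inj, Prod.ext_iff]

theorem consistent_ttcState (hinit : pb.Satisfies pb.balancedPolicy pb.initMatching) (n : ℕ) :
    pb.Consistent (pb.ttcState pb.exchangePolicy master Q n) := by
  classical
  induction n with
  | succ n ih =>
    rw [ttcState_succ]
    exact ih.ttcStep
  | zero =>
    refine ⟨?_, fun _ _ => Set.mem_univ _⟩
    have hdist : pb.dist pb.initMatching = pairDist pb.initPair :=
      dist_eq_pairDist (fun _ => rfl) fun _ => rfl
    change pairDist pb.initPair ∈ _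
    refine (pb.mem_exchangePolicy_iff _).2 ⟨hdist ▸ hinit, fun c => ?_⟩
    rw [mass_pairDist, ← Fintype.card_subtype, ← Nat.card_eq_fintype_card]
    exact pb.init_feasible c

theorem ttcState_assigned_mono {m n : ℕ} (hmn : m ≤ n) {s : S} {p : C × T}
    (h : (pb.ttcState Ξ master Q m).assigned s = some p) :
    (pb.ttcState Ξ master Q n).assigned s = some p := by
  induction n, hmn using Nat.le_induction with
  | base => exact h
  | succ n _ ih =>
    rw [ttcState_succ]
    exact ttcStep_assigned_of_eq_some ih

theorem ttcState_unassigned_anti {m n : ℕ} (hmn : m ≤ n) {s : S}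
    (h : (pb.ttcState Ξ master Q n).assigned s = none) :
    (pb.ttcState Ξ master Q m).assigned s = none := by
  by_contra hne
  obtain ⟨p, hp⟩ := Option.ne_none_iff_exists'.1 hne
  simp [ttcState_assigned_mono hmn hp] at h

theorem not_onCycle_of_unassigned {m n : ℕ} (hmn : m < n) {s : S}
    (h : (pb.ttcState Ξ master Q n).assigned s = none) :
    ¬ pb.OnCycle Ξ master Q (pb.ttcState Ξ master Q m) s := by
  have := ttcState_unassigned_anti (Nat.succ_le_of_lt hmn) h
  rw [ttcState_succ, ttcStep_assigned_eq_none_iff] at this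
  exact this.2

theorem exists_onCycle_of_assigned {n : ℕ} {s : S} {p : C × T}
    (h : (pb.ttcState Ξ master Q n).assigned s = some p) :
    ∃ m < n, pb.OnCycle Ξ master Q (pb.ttcState Ξ master Q m) s ∧
      pb.StudentPoints Ξ Q (pb.ttcState Ξ master Q m) s p := by
  induction n with
  | zero => simp [ttcState, ttcStart] at h
  | succ n ih =>
    rw [ttcState_succ] at h
    by_cases hc : pb.OnCycle Ξ master Q (pb.ttcState Ξ master Q n) s
    · obtain ⟨q, hq⟩ := hc.exists_studentPoints
      rw [ttcStep_assigned_of_onCycle hc hq, Option.some_inj] at h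
      exact ⟨n, n.lt_succ_self, hc, h ▸ hq⟩
    · rw [ttcStep_assigned_of_not_onCycle hc] at h
      obtain ⟨m, hm, hm'⟩ := ih h
      exact ⟨m, hm.trans n.lt_succ_self, hm'⟩

theorem remaining_ttcState_anti {m n : ℕ} (hmn : m ≤ n) :
    pb.remaining Ξ (pb.ttcState Ξ master Q n) ⊆ pb.remaining Ξ (pb.ttcState Ξ master Q m) := by
  induction n, hmn using Nat.le_induction with
  | base => exact subset_rfl
  | succ n _ ih =>
    rw [ttcState_succ]
    exact fun p hp => ih hp.1

/-- A pair that is not in the market was removed when nobody was permissible to it. -/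
theorem exists_removal {n : ℕ} {p : C × T}
    (h : p ∉ pb.remaining Ξ (pb.ttcState Ξ master Q n)) :
    ∃ m ≤ n, ∀ s, ¬ pb.Permissible Ξ (pb.ttcState Ξ master Q m) s p := by
  induction n with
  | zero => exact ⟨0, le_rfl, fun s hs => h ⟨Set.mem_univ _, s, hs⟩⟩
  | succ n ih =>
    by_cases hp : p ∈ pb.remaining Ξ (pb.ttcState Ξ master Q n)
    · refine ⟨n + 1, le_rfl, fun s hs => h ⟨?_, s, hs⟩⟩
      rw [ttcState_succ]
      exact hp
    · obtain ⟨m, hm, hm'⟩ := ih hp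
      exact ⟨m, hm.trans n.le_succ, hm'⟩

/-- Every step processes a student as long as there is one. -/
theorem ttcTerminates (hinit : pb.Satisfies pb.balancedPolicy pb.initMatching) :
    pb.TTCTerminates pb.exchangePolicy master Q := by
  classical
  by_contra hcon
  simp only [TTCTerminates, TTCDoneAt, not_exists, not_forall, not_not] at hcon
  refine not_strictAnti_of_wellFoundedLT
    (fun n => #{s | (pb.ttcState pb.exchangePolicy master Q n).assigned s = none})
    (strictAnti_nat_of_succ_lt fun n => card_lt_card ?_)
  obtain ⟨s, hs⟩ := hcon n
  obtain ⟨a, ha⟩ := (consistent_ttcState hinit n).exists_onCycle (master := master) (Q := Q) hs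
  refine (ssubset_iff_of_subset fun u => ?_).2 ⟨a, by simpa using ha.unassigned, ?_⟩
  · simpa using fun hu => ttcState_unassigned_anti n.le_succ hu
  · rw [mem_filter, ttcState_succ, ttcStep_assigned_eq_none_iff]
    tauto

/-- The assignment `x` of students to pairs is the one made by the algorithm: each student is on
a cycle and points to her pair at some step, the final assignments of all states agree with `x`,
and the distribution of `x` satisfies the constraint. -/
structure IsRunOutcome (pb : Problem S D C T) (master : StrictPref S)
    (Q : S → StrictPref (C × T)) (x : S → C × T) : Prop where
  outcome_eq : ∀ s, pb.ttcOutcome pb.exchangePolicy master Q s = some (x s).1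
  exists_step : ∀ s, ∃ n,
    pb.OnCycle pb.exchangePolicy master Q (pb.ttcState pb.exchangePolicy master Q n) s ∧
      pb.StudentPoints pb.exchangePolicy Q (pb.ttcState pb.exchangePolicy master Q n) s (x s)
  eq_of_assigned : ∀ n s p,
    (pb.ttcState pb.exchangePolicy master Q n).assigned s = some p → p = x s
  dist_mem : pairDist x ∈ pb.exchangePolicy

theorem exists_isRunOutcome (hinit : pb.Satisfies pb.balancedPolicy pb.initMatching) :
    ∃ x, pb.IsRunOutcome master Q x := by
  classical
  have hterm := ttcTerminates (master := master) (Q := Q) hinit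
  have hdone : pb.TTCDoneAt pb.exchangePolicy master Q (Nat.find hterm) := Nat.find_spec hterm
  have hex : ∀ s, ∃ p,
      (pb.ttcState pb.exchangePolicy master Q (Nat.find hterm)).assigned s = some p :=
    fun s => Option.ne_none_iff_exists'.1 (hdone s)
  choose x hx using hex
  refine ⟨x, fun s => ?_, fun s => ?_, fun n s p hp => ?_, ?_⟩
  · rw [ttcOutcome, dif_pos hterm]
    exact congrArg (Option.map Prod.fst) (hx s)
  · obtain ⟨n, -, hn⟩ := exists_onCycle_of_assigned (hx s)
    exact ⟨n, hn⟩
  · have h1 := ttcState_assigned_mono (le_max_left n (Nat.find hterm)) hp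
    have h2 := ttcState_assigned_mono (le_max_right n (Nat.find hterm)) (hx s)
    exact Option.some_inj.1 (h1.symm.trans h2)
  · have := (consistent_ttcState (master := master) (Q := Q) hinit (Nat.find hterm)).dist_mem
    convert this using 1
    change _ = pairDist _
    congr 1
    funext s
    simp [currentPair, hx]

end Run

/-! ### Properties of the outcome -/

section Outcome

variable {pb : Problem S D C T} {master : StrictPref S} {Q : S → StrictPref (C × T)}
  {P : S → StrictPref C} {x : S → C × T}

theorem IsRunOutcome.snd_eq (h : pb.IsRunOutcome master Q x)
    (hinit : pb.Satisfies pb.balancedPolicy pb.initMatching)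
    (hQ : ∀ s, pb.IsPairPref s (P s) (Q s)) (s : S) : (x s).2 = pb.type s := by
  obtain ⟨n, -, hn⟩ := h.exists_step s
  exact hn.snd_eq (consistent_ttcState hinit n) (hQ s)

theorem feasible_of_dist_mem {X : Matching S C} {x : S → C × T} (hX : ∀ s, X s = some (x s).1)
    (h : pairDist x ∈ pb.exchangePolicy) : pb.Feasible X := by
  classical
  intro c
  have := ((pb.mem_exchangePolicy_iff _).1 h).2 c
  rw [mass_pairDist] at this
  simpa [hX, Fintype.card_subtype] using this

/-- If every district ends up with as many students as it has residents, then the students coming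
in and those going out are what remains of the two after taking away those who stay. -/
theorem balancedExchange_of_dist_mem {X : Matching S C} {x : S → C × T}
    (hX : ∀ s, X s = some (x s).1) (h : pairDist x ∈ pb.balancedPolicy) :
    pb.BalancedExchange X := by
  classical
  intro d
  have hd : mass (pairDist x) (fun c => pb.district c = d) = pb.numHome d := h d
  rw [mass_pairDist, numHome, Nat.card_eq_fintype_card, Fintype.card_subtype] at hd
  simp only [hX, Option.some_inj, exists_eq_left', Nat.card_eq_fintype_card, Fintype.card_subtype]
  have h1 := card_filter_add_card_filter_not (s := {s | pb.district (x s).1 = d})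
    (fun s => pb.home s = d)
  have h2 := card_filter_add_card_filter_not (s := {s | pb.home s = d})
    (fun s => pb.district (x s).1 = d)
  simp only [filter_filter] at h1 h2
  simp only [and_comm] at h1 h2 ⊢
  simp only [ne_eq]
  omega

theorem IsRunOutcome.individuallyRational (h : pb.IsRunOutcome master Q x)
    (hinit : pb.Satisfies pb.balancedPolicy pb.initMatching)
    (hQ : ∀ s, pb.IsPairPref s (P s) (Q s)) :
    pb.IndividuallyRational P (pb.ttcOutcome pb.exchangePolicy master Q) := by
  intro s
  rw [h.outcome_eq]
  obtain ⟨n, -, hn⟩ := h.exists_step s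
  have hmem := (consistent_ttcState hinit n).initPair_mem_remaining hn.1
  rcases hn.eq_or_pref hmem with he | hp
  · exact .inr (by rw [he]; rfl)
  · refine .inl (((hQ s).1 _ _).2 ?_)
    rw [← h.snd_eq hinit hQ s]
    convert hp using 1
    exact Prod.ext rfl (h.snd_eq hinit hQ s)

/-- Let `s` be among the first processed students to whom a dominating matching `y` gives another
school. The school `y s` was out of the market, hence full or in a district with no unprocessed
student, and all students then at the school, respectively in the district, were processed. They
have the same school at `y`, and with `s` there are too many. -/
theorem IsRunOutcome.not_paretoDominates (h : pb.IsRunOutcome master Q x)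
    (hinit : pb.Satisfies pb.balancedPolicy pb.initMatching)
    (hQ : ∀ s, pb.IsPairPref s (P s) (Q s)) {Y : Matching S C} (hfeas : pb.Feasible Y)
    (hbal : pb.Satisfies pb.balancedPolicy Y) :
    ¬ ParetoDominates P Y (pb.ttcOutcome pb.exchangePolicy master Q) := by
  classical
  rintro ⟨hweak, s₀, hs₀⟩
  have hY : ∀ s, ∃ c, Y s = some c := by
    intro s
    have := hweak s
    rw [h.outcome_eq] at this
    rcases hys : Y s with _ | c
    · simp [StrictPref.weak, StrictPref.over, hys] at this
    · exact ⟨c, rfl⟩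
  choose y hy using hY
  simp only [h.outcome_eq, hy] at hweak hs₀
  have hex : ∃ n s, pb.OnCycle pb.exchangePolicy master Q
      (pb.ttcState pb.exchangePolicy master Q n) s ∧ y s ≠ (x s).1 := by
    obtain ⟨n, hn, -⟩ := h.exists_step s₀
    refine ⟨n, s₀, hn, fun he => ?_⟩
    rw [he] at hs₀
    exact (P s₀).irrefl _ hs₀
  obtain ⟨s, hcyc, hne⟩ := Nat.find_spec hex
  set n := Nat.find hex with hn
  have hsame : ∀ m ≤ n, ∀ u,
      (pb.ttcState pb.exchangePolicy master Q m).assigned u ≠ none →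
        (pb.currentPair (pb.ttcState pb.exchangePolicy master Q m) u).1 = y u := by
    intro m hm u hu
    obtain ⟨p, hp⟩ := Option.ne_none_iff_exists'.1 hu
    obtain ⟨k, hk, hku, -⟩ := exists_onCycle_of_assigned hp
    have := Nat.find_min hex (hk.trans_le hm)
    simp only [not_exists, not_and, not_not] at this
    rw [this u hku, currentPair, hp, Option.getD_some, h.eq_of_assigned m u p hp]
  have hout : (y s, pb.type s) ∉
      pb.remaining pb.exchangePolicy (pb.ttcState pb.exchangePolicy master Q n) := by
    intro hmem
    obtain ⟨p, hp⟩ := hcyc.exists_studentPoints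
    have hpx : p = x s := h.eq_of_assigned (n + 1) s p (by
      rw [ttcState_succ]
      exact ttcStep_assigned_of_onCycle hcyc hp)
    subst hpx
    have hpref : (Q s).pref (y s, pb.type s) (x s) := by
      have h1 : (P s).pref (y s) (x s).1 :=
        (hweak s).resolve_right fun he => hne (Option.some_inj.1 he)
      have h2 := ((hQ s).1 _ _).1 h1
      rw [← h.snd_eq hinit hQ s] at h2 ⊢
      exact h2
    rcases hp.eq_or_pref hmem with he | h3
    · rw [he] at hpref
      exact (Q s).irrefl _ hpref
    · exact (Q s).asymm hpref h3
  obtain ⟨m, hm, hnone⟩ := exists_removal hout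
  have hcons := consistent_ttcState (master := master) (Q := Q) hinit m
  have hs := ttcState_unassigned_anti hm hcyc.unassigned
  set σ := pb.ttcState pb.exchangePolicy master Q m
  -- Used with `φ` "the school is `y s`" and with `φ` "the district is the one of `y s`".
  have hcount : ∀ φ : C → Prop, φ (y s) →
      (∀ u, σ.assigned u = none → ¬ φ (pb.init u)) → pb.load σ φ < #{u | φ (y u)} := by
    intro φ hφ hun
    rw [load_eq_card]
    refine card_lt_card ((ssubset_iff_of_subset fun u => ?_).2 ⟨s, by simpa using hφ, ?_⟩)
    · simp only [mem_filter, mem_univ, true_and]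
      intro hu
      by_cases hua : σ.assigned u = none
      · rw [currentPair_of_unassigned hua] at hu
        exact absurd hu (hun u hua)
      · rwa [← hsame m hm u hua]
    · simpa [currentPair_of_unassigned hs, initPair] using hun s hs
  by_cases hfree : pb.load σ (· = y s) < pb.cap (y s)
  · have hlt := hcount (fun c => pb.district c = pb.district (y s)) rfl fun u hu hd =>
      hnone u (hcons.permissible_iff.2 ⟨hu, hd.symm, .inr hfree⟩)
    have hd := ((pb.mem_exchangePolicy_iff _).1 hcons.dist_mem).1 (pb.district (y s))
    have hdY : mass (pb.dist Y) (fun c => pb.district c = pb.district (y s)) =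
        pb.numHome (pb.district (y s)) := hbal _
    rw [dist_eq_pairDist (x := fun u => (y u, pb.type u)) hy fun _ => rfl, mass_pairDist] at hdY
    dsimp only at hdY
    change pb.load σ _ = _ at hd
    omega
  · have hlt := hcount (· = y s) rfl fun u hu hc =>
      hnone u (hcons.permissible_init hu hc)
    have hcap := hfeas (y s)
    simp only [hy, Option.some_inj, Nat.card_eq_fintype_card, Fintype.card_subtype] at hcap
    omega

/-! ### Strategy-proofness -/

theorem ttcState_congr {Ξ : Set (Distribution C T)} {Q' : S → StrictPref (C × T)} {s : S}
    (hQ : ∀ u, u ≠ s → Q u = Q' u) {n : ℕ}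
    (h : (pb.ttcState Ξ master Q n).assigned s = none)
    (h' : (pb.ttcState Ξ master Q' n).assigned s = none) :
    pb.ttcState Ξ master Q n = pb.ttcState Ξ master Q' n := by
  induction n with
  | zero => rfl
  | succ n ih =>
    have heq := ih (ttcState_unassigned_anti n.le_succ h) (ttcState_unassigned_anti n.le_succ h')
    have h1 := not_onCycle_of_unassigned n.lt_succ_self h
    have h2 := not_onCycle_of_unassigned n.lt_succ_self h'
    rw [ttcState_succ, ttcState_succ, ← heq]
    rw [← heq] at h2
    exact ttcStep_congr hQ h1 h2

theorem leadsTo_ttcState (hinit : pb.Satisfies pb.balancedPolicy pb.initMatching) {m n : ℕ}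
    (hmn : m ≤ n) {p : C × T} {s : S}
    (hs : (pb.ttcState pb.exchangePolicy master Q n).assigned s = none)
    (hp : pb.LeadsTo pb.exchangePolicy master Q
      (pb.ttcState pb.exchangePolicy master Q m) p s) :
    pb.LeadsTo pb.exchangePolicy master Q (pb.ttcState pb.exchangePolicy master Q n) p s := by
  induction n, hmn using Nat.le_induction with
  | base => exact hp
  | succ n _ ih =>
    have h1 := ih (ttcState_unassigned_anti n.le_succ hs)
    have h2 := not_onCycle_of_unassigned n.lt_succ_self hs
    rw [ttcState_succ]
    exact (consistent_ttcState hinit n).leadsTo_ttcStep h1 h2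

/-- Any pair that `s` obtains under another report is still in the market when she is processed
under `Q`: if the other report gets her processed later, because markets shrink, and if it gets
her processed earlier, because the path from that pair to her persists. -/
theorem IsRunOutcome.eq_or_pref_of_agree_off (h : pb.IsRunOutcome master Q x)
    (hinit : pb.Satisfies pb.balancedPolicy pb.initMatching) {Q' : S → StrictPref (C × T)}
    {x' : S → C × T} (h' : pb.IsRunOutcome master Q' x') {s : S}
    (hQ : ∀ u, u ≠ s → Q u = Q' u) : x s = x' s ∨ (Q s).pref (x s) (x' s) := by
  obtain ⟨n, -, hn⟩ := h.exists_step s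
  obtain ⟨m, hcyc, hm⟩ := h'.exists_step s
  refine hn.eq_or_pref ?_
  rcases le_total n m with hnm | hmn
  · rw [ttcState_congr hQ hn.1 (ttcState_unassigned_anti hnm hm.1)]
    exact remaining_ttcState_anti hnm hm.2.1
  · have heq := ttcState_congr hQ (ttcState_unassigned_anti hmn hn.1) hm.1
    have hlead : pb.LeadsTo pb.exchangePolicy master Q
        (pb.ttcState pb.exchangePolicy master Q m) (x' s) s := by
      obtain ⟨b, ⟨p, hsp, hpb⟩, hpath⟩ := TransGen.head'_iff.1 hcyc
      obtain rfl := hm.unique hsp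
      rw [heq]
      refine ⟨b, hpb, ReflTransGen.mono ?_ b s (reflTransGen_stop hpath)⟩
      intro u v huv
      refine ⟨huv.1, ?_⟩
      simpa only [Arc, StudentPoints, hQ u huv.1] using huv.2
    obtain ⟨b, hb, -⟩ := leadsTo_ttcState hinit hmn hn.1 hlead
    exact hb.1

theorem strategyProof_ttc (hinit : pb.Satisfies pb.balancedPolicy pb.initMatching)
    {ext : S → StrictPref C → StrictPref (C × T)} (hext : ∀ s P, pb.IsPairPref s P (ext s P)) :
    StrategyProof (pb.ttc pb.exchangePolicy master ext) := by
  classical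
  intro P s P' hover
  obtain ⟨x, hx⟩ := exists_isRunOutcome (master := master) (Q := fun u => ext u (P u)) hinit
  obtain ⟨x', hx'⟩ := exists_isRunOutcome (master := master)
    (Q := fun u => ext u (Function.update P s P' u)) hinit
  have hcmp := hx.eq_or_pref_of_agree_off hinit hx' (s := s) fun u hu => by
    rw [Function.update_of_ne hu]
  have hpref : (P s).pref (x' s).1 (x s).1 := by
    have h1 := hx.outcome_eq s
    have h2 := hx'.outcome_eq s
    simp only [ttc] at hover
    rw [h1] at hover
    have h3 : (P s).over (some (x' s).1) (some (x s).1) := by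
      rw [← h2]
      convert hover
    exact h3
  have hpair := ((hext s (P s)).1 _ _).1 hpref
  have ht := hx.snd_eq hinit (fun u => hext u (P u)) s
  have ht' := hx'.snd_eq hinit (fun u => hext u (Function.update P s P' u)) s
  have hpair' : (ext s (P s)).pref (x' s) (x s) := by
    rwa [show x' s = ((x' s).1, pb.type s) from Prod.ext rfl ht',
      show x s = ((x s).1, pb.type s) from Prod.ext rfl ht]
  rcases hcmp with he | hp
  · rw [he] at hpair'
    exact (ext s (P s)).irrefl _ hpair'
  · exact (ext s (P s)).asymm hp hpair'

end Outcome

end Problem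
end SchoolChoice

theorem corollary4 {S D C T : Type*} [Fintype S] [Fintype D] [Fintype C] [Fintype T]
    (pb : SchoolChoice.Problem S D C T) :
    SchoolChoice.MConvex (pb.balancedPolicy ∩ pb.policyZero) ∧
    (pb.Satisfies pb.balancedPolicy pb.initMatching →
      ∀ (master : SchoolChoice.StrictPref S)
        (ext : S → SchoolChoice.StrictPref C → SchoolChoice.StrictPref (C × T)),
        (∀ s P, pb.IsPairPref s P (ext s P)) →
        (∀ P : S → SchoolChoice.StrictPref C,
          pb.TTCTerminates (pb.balancedPolicy ∩ pb.policyZero) master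
            (fun s => ext s (P s)) ∧
          pb.Feasible (pb.ttc (pb.balancedPolicy ∩ pb.policyZero) master ext P) ∧
          pb.Satisfies pb.balancedPolicy
            (pb.ttc (pb.balancedPolicy ∩ pb.policyZero) master ext P) ∧
          pb.BalancedExchange (pb.ttc (pb.balancedPolicy ∩ pb.policyZero) master ext P) ∧
          pb.ConstrainedEfficient pb.balancedPolicy P
            (pb.ttc (pb.balancedPolicy ∩ pb.policyZero) master ext P) ∧
          pb.IndividuallyRational P
            (pb.ttc (pb.balancedPolicy ∩ pb.policyZero) master ext P)) ∧
        SchoolChoice.StrategyProof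
          (pb.ttc (pb.balancedPolicy ∩ pb.policyZero) master ext)) := by
  refine ⟨pb.mConvex_exchangePolicy, fun hinit master ext hext => ⟨fun P => ?_,
    SchoolChoice.Problem.strategyProof_ttc hinit hext⟩⟩
  have hQ := fun s => hext s (P s)
  obtain ⟨x, hx⟩ := SchoolChoice.Problem.exists_isRunOutcome (master := master)
    (Q := fun s => ext s (P s)) hinit
  have hfeas := SchoolChoice.Problem.feasible_of_dist_mem hx.outcome_eq hx.dist_mem
  have hsat : pb.Satisfies pb.balancedPolicy (pb.ttc pb.exchangePolicy master ext P) := by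
    have hdist := SchoolChoice.Problem.dist_eq_pairDist hx.outcome_eq (hx.snd_eq hinit hQ)
    change pb.dist (pb.ttcOutcome _ _ _) ∈ _
    rw [hdist]
    exact hx.dist_mem.1
  exact ⟨SchoolChoice.Problem.ttcTerminates hinit, hfeas, hsat,
    SchoolChoice.Problem.balancedExchange_of_dist_mem hx.outcome_eq hx.dist_mem.1,
    ⟨hfeas, hsat, fun ⟨_, hYf, hYb, hdom⟩ => hx.not_paretoDominates hinit hQ hYf hYb hdom⟩,
    hx.individuallyRational hinit hQ⟩
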